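/- **Setting.** Players $i=1,\dots,N$, horizon $T$, and a probability space $(\Xi,\mathcal F,\mathbb P)$ carrying a random disturbance $w=\mathrm{col}(w_0,\dots,w_{T-1})$ with $w_t\in\mathbb R^{n_s}$. Player $i$ chooses $u^i=\mathrm{col}(u^i_0,\dots,u^i_{T-1})\in\mathcal D^i=\prod_t\mathcal D^i_t$, where each $\mathcal D^i_t\subseteq\mathbb R^{n_i}$ is nonempty, compact and convex; $u=\mathrm{col}(u^1,\dots,u^N)\in\mathcal D=\prod_i\mathcal D^i$. Starting from a known $s_0$, the state follows $s_{t+1}=A_ts_t+\sum_jB^j_tu^j_t+w_t$, and $s=\mathrm{col}(s_0,\dots,s_T)$. Put $$J^i(s_0,u,w)=\hat J^i(s)+\tilde J^i(u),\qquad \mathbb J^i(s_0,u)=\mathbb E_w[J^i(s_0,u,w)],\qquad \bar\xi^j(s_0,u,w)=\hat\xi^j(s)+\tilde\xi^j(u),\quad j=1,\dots,m,$$ where $\hat J^i,\hat\xi^j:\mathbb R^{(T+1)n_s}\to\mathbb R$ and $\tilde J^i,\tilde\xi^j:\mathbb R^{T\sum_in_i}\to\mathbb R$. Let $\gamma^j\in(0,1)$,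 $\beta^j\ge0$, $h:\mathbb R_{\ge0}\to\mathbb R$, and $g^j=\bar\xi^j+h^{-1}(\gamma^j)+\beta^j$, where $h^{-1}(c)=\inf\{\theta\ge0: h(\theta)\le c\}$ (the ordinary inverse when $h$ is injective and attains $c$). The game $\mathcal G_2$ has the costs $\mathbb J^i$ and the coupled feasible set $$\mathcal U_{\mathcal G_2}(s_0)=\{u\in\mathcal D:\ \mathbb E_w[g^j(s_0,u,w)]\text{ exists and is}\le0,\ j=1,\dots,m\}.$$ An SGNE of $\mathcal G_2$ is a $u_\star\in\mathcal U_{\mathcal G_2}(s_0)$ such that $\mathbb J^i(s_0,u_\star)\le\mathbb J^i(s_0,y,u_\star^{-i})$ for every $i$ and every $y\in\mathcal D^i$ with $(y,u_\star^{-i})\in\mathcal U_{\mathcal G_2}(s_0)$. With $\mathbb F_{\mathcal G_2}(s_0,u)=\mathrm{col}\big(\mathbb E_w[\nabla_{u^1}J^1(s_0,u,w)],\dots,\mathbb E_w[\nabla_{u^N}J^N(s_0,u,w)]\big)$, a solution of $\mathrm{SVI}(\mathcal U_{\mathcal G_2},\mathbb F_{\mathcal G_2})$ is a $u_\star\in\mathcal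 U_{\mathcal G_2}(s_0)$ at which these expectations exist and $\langle\mathbb F_{\mathcal G_2}(s_0,u_\star),u-u_\star\rangle\ge0$ for all $u\in\mathcal U_{\mathcal G_2}(s_0)$. A variational SGNE is an SGNE that solves this SVI. **Assumptions.** 1. For all $i$: $J^i(s_0,u,\cdot)$ is integrable for every $u\in\mathbb R^{T\sum_in_i}$; $\hat J^i$ is convex and differentiable; $\tilde J^i$ is continuous, and convex and differentiable in $u^i$ for fixed $u^{-i}$. 2. For all $j$: $\hat\xi^j$ is convex and differentiable; for each $i$, $\tilde\xi^j$ is convex and differentiable in $u^i$ for fixed $u^{-i}$. 3. (Concentration of measure.) $h$ is nonincreasing with values in $[0,1]$, and for each $j$ there is $\theta\ge0$ with $h(\theta)\le\gamma^j$. There is a class $\mathcal C$ of integrable functions $\phi:\Xi\to\mathbb R$ such that $\mathbb P\{|\phi-\mathbb E[\phi]|\le\theta\}\ge1-h(\theta)$ for all $\phi\in\mathcal C$ and $\theta\ge0$, and $\bar\xi^j(s_0,u,\cdot)\in\mathcal C$ for all $j$ and $u\in\mathcal D$. 4. (Slater and regularity.) The functions $u\mapsto\mathbb E_w[g^j(s_0,u,w)]$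 are convex on $\mathcal D$, and some $u\in\mathcal D$ satisfies $\mathbb E_w[g^j(s_0,u,w)]<0$ for all $j$. For every value of $w$: $g(s_0,\cdot,w)$ is Lipschitz on $\mathcal D$ with a constant $\ell_g(s_0,w)$; $\|g\|\le B_{1g}(s_0,w)$ and $\|\nabla_ug\|\le B_{2g}(s_0,w)$ on $\mathcal U_{\mathcal G_2}(s_0)$; and for each $i$ and $u^{-i}\in\mathcal D^{-i}$, $J^i(s_0,\cdot,u^{-i},w)$ is Lipschitz on $\mathcal D^i$ with a constant $\ell_{J^i}(s_0,u^{-i},w)$. The constants $\ell_g,B_{1g},B_{2g},\ell_{J^i}$ are integrable in $w$. **Proposition.** Under Assumptions 1–4 the solution set of $\mathrm{SVI}(\mathcal U_{\mathcal G_2},\mathbb F_{\mathcal G_2})$ is nonempty. Hence a variational SGNE of $\mathcal G_2$ exists. -/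

import Mathlib

open MeasureTheory
open scoped NNReal

noncomputable section

/-- `ℝ^{T k}`: the strategies `col (u_0, …, u_{T-1})` of a player with `u_t ∈ ℝ^k`, with the
Euclidean inner product. -/
abbrev StrategySpace (T k : ℕ) : Type :=
  PiLp 2 (fun _ : Fin T => EuclideanSpace ℝ (Fin k))

/-- `ℝ^{T ∑ n_i}`: the strategy profiles `col (u^1, …, u^N)`, with the Euclidean inner product. -/
abbrev ProfileSpace (N T : ℕ) (n : Fin N → ℕ) : Type :=
  PiLp 2 (fun i : Fin N => StrategySpace T (n i))

/-- `ℝ^{(T+1) ns}`: the state profiles `col (s_0, …, s_T)`. -/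
abbrev StateSpace (T ns : ℕ) : Type :=
  PiLp 2 (fun _ : Fin (T + 1) => EuclideanSpace ℝ (Fin ns))

/-- The profile `(v, u^{-i})`: player `i` plays `v`, the others play as in `u`. -/
def deviate {N T : ℕ} {n : Fin N → ℕ} (u : ProfileSpace N T n) (i : Fin N)
    (v : StrategySpace T (n i)) : ProfileSpace N T n :=
  WithLp.toLp 2 (Function.update (fun k => u k) i v)

/-- Data of a stochastic generalized dynamic game with `N` players, horizon `T`, states in
`ℝ^ns`, actions of player `i` in `ℝ^{n i}` and `m` coupling constraints, together with the
data `h`, `β` of the convex under-approximation of its chance constraints.  The sample space of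
the disturbance is `Ω`. -/
structure SGDG (Ω : Type*) [MeasurableSpace Ω] (N T ns m : ℕ) (n : Fin N → ℕ) where
  /-- the probability measure -/
  P : Measure Ω
  isProb : IsProbabilityMeasure P
  /-- the disturbance `w_t` -/
  w : Fin T → Ω → EuclideanSpace ℝ (Fin ns)
  measurable_w : ∀ t, Measurable (w t)
  /-- the known initial state -/
  s₀ : EuclideanSpace ℝ (Fin ns)
  /-- the system matrices -/
  A : Fin T → Matrix (Fin ns) (Fin ns) ℝ
  B : (i : Fin N) → Fin T → Matrix (Fin ns) (Fin (n i)) ℝ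
  /-- the local action sets -/
  D : (i : Fin N) → Fin T → Set (EuclideanSpace ℝ (Fin (n i)))
  nonempty_D : ∀ i t, (D i t).Nonempty
  compact_D : ∀ i t, IsCompact (D i t)
  convex_D : ∀ i t, Convex ℝ (D i t)
  /-- state-dependent and strategy-dependent parts of the costs -/
  costState : Fin N → StateSpace T ns → ℝ
  costStrat : Fin N → ProfileSpace N T n → ℝ
  /-- state-dependent and strategy-dependent parts of the constraint functions -/
  conState : Fin m → StateSpace T ns → ℝ
  conStrat : Fin m → ProfileSpace N T n → ℝ
  /-- the violation tolerances -/
  γ : Fin m → ℝ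
  γ_pos : ∀ j, 0 < γ j
  γ_lt_one : ∀ j, γ j < 1
  /-- the concentration function -/
  h : ℝ≥0 → ℝ
  /-- the tightening parameters -/
  β : Fin m → ℝ
  β_nonneg : ∀ j, 0 ≤ β j

namespace SGDG

variable {Ω : Type*} [MeasurableSpace Ω] {N T ns m : ℕ} {n : Fin N → ℕ}

/-- The state at time `t`, defined by
`s_{t+1} = A_t s_t + ∑_j B^j_t u^j_t + w_t` from the initial state `s₀`. -/
def stateAt (G : SGDG Ω N T ns m n) (u : ProfileSpace N T n) (ω : Ω) (t : Fin (T + 1)) :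
    EuclideanSpace ℝ (Fin ns) :=
  Fin.induction (motive := fun _ => EuclideanSpace ℝ (Fin ns)) G.s₀
    (fun t s => (G.A t).toEuclideanLin s + ∑ j, (G.B j t).toEuclideanLin (u j t) + G.w t ω) t

/-- The state profile `s = col (s_0, …, s_T)` as a function of the strategies and the noise. -/
def state (G : SGDG Ω N T ns m n) (u : ProfileSpace N T n) (ω : Ω) : StateSpace T ns :=
  WithLp.toLp 2 (fun t => G.stateAt u ω t)

/-- The sampled cost `J^i(s_0, u, w)`. -/
def cost (G : SGDG Ω N T ns m n) (i : Fin N) (u : ProfileSpace N T n) (ω : Ω) : ℝ :=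
  G.costState i (G.state u ω) + G.costStrat i u

/-- The expected cost of player `i`. -/
def expCost (G : SGDG Ω N T ns m n) (i : Fin N) (u : ProfileSpace N T n) : ℝ :=
  ∫ ω, G.cost i u ω ∂G.P

/-- The sampled constraint function `ξ̄^j(s_0, u, w)`. -/
def con (G : SGDG Ω N T ns m n) (j : Fin m) (u : ProfileSpace N T n) (ω : Ω) : ℝ :=
  G.conState j (G.state u ω) + G.conStrat j u

/-- The (generalized) inverse of the decreasing function `h`: the infimum of the `θ ≥ 0` with
`h θ ≤ c`, which is the ordinary `h⁻¹(c)` when `h` is injective and takes the value `c`. -/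
def hInv (G : SGDG Ω N T ns m n) (c : ℝ) : ℝ :=
  ((sInf {θ : ℝ≥0 | G.h θ ≤ c} : ℝ≥0) : ℝ)

/-- The tightened constraint vector `g = ξ̄ + h⁻¹(γ) + β`. -/
def g (G : SGDG Ω N T ns m n) (u : ProfileSpace N T n) (ω : Ω) : EuclideanSpace ℝ (Fin m) :=
  WithLp.toLp 2 (fun j => G.con j u ω + G.hInv (G.γ j) + G.β j)

/-- The expected constraint function `u ↦ E[g^j(s_0, u, w)]`. -/
def expCon (G : SGDG Ω N T ns m n) (j : Fin m) (u : ProfileSpace N T n) : ℝ :=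
  ∫ ω, G.g u ω j ∂G.P

/-- The strategy set `D^i = ∏_t D^i_t` of player `i`. -/
def localSet (G : SGDG Ω N T ns m n) (i : Fin N) : Set (StrategySpace T (n i)) :=
  {v | ∀ t, v t ∈ G.D i t}

/-- The set of profiles `D = ∏_i D^i`. -/
def profileSet (G : SGDG Ω N T ns m n) : Set (ProfileSpace N T n) :=
  {u | ∀ i, u i ∈ G.localSet i}

/-- The coupled feasible set `D ∩ {u | E[g(s_0, u, w)] ≤ 0}` of the under-approximated game. -/
def feasibleSet (G : SGDG Ω N T ns m n) : Set (ProfileSpace N T n) :=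
  {u | u ∈ G.profileSet ∧ ∀ j, Integrable (fun ω => G.g u ω j) G.P ∧ G.expCon j u ≤ 0}

/-- The feasible strategies of player `i` against `u^{-i}` in the under-approximated game. -/
def playerFeasibleSet (G : SGDG Ω N T ns m n) (i : Fin N) (u : ProfileSpace N T n) :
    Set (StrategySpace T (n i)) :=
  {v | v ∈ G.localSet i ∧ deviate u i v ∈ G.feasibleSet}

/-- `u` is a stochastic generalized Nash equilibrium of the under-approximated game. -/
def IsSGNE (G : SGDG Ω N T ns m n) (u : ProfileSpace N T n) : Prop :=
  u ∈ G.feasibleSet ∧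
    ∀ i, ∀ y ∈ G.playerFeasibleSet i u, G.expCost i u ≤ G.expCost i (deviate u i y)

/-- The partial gradient `∇_{u^i} J^i(s_0, u^i, u^{-i}, w)`. -/
def gradCost (G : SGDG Ω N T ns m n) (i : Fin N) (u : ProfileSpace N T n) (ω : Ω) :
    StrategySpace T (n i) :=
  gradient (fun v => G.cost i (deviate u i v) ω) (u i)

/-- The pseudo-gradient mapping `col (E[∇_{u^1} J^1], …, E[∇_{u^N} J^N])`. -/
def pseudoGradient (G : SGDG Ω N T ns m n) (u : ProfileSpace N T n) : ProfileSpace N T n :=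
  WithLp.toLp 2 (fun i => ∫ ω, G.gradCost i u ω ∂G.P)

/-- The solution set of the stochastic variational inequality: the feasible `u` at which the
expectations in the pseudo-gradient exist and
`⟨F(u), v - u⟩ ≥ 0` for all feasible `v`. -/
def sviSolutions (G : SGDG Ω N T ns m n) : Set (ProfileSpace N T n) :=
  {u | u ∈ G.feasibleSet ∧ (∀ i, Integrable (fun ω => G.gradCost i u ω) G.P) ∧
    ∀ v ∈ G.feasibleSet, 0 ≤ inner ℝ (G.pseudoGradient u) (v - u)}

/-- Variational equilibria: equilibria that solve the variational inequality. -/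
def IsVariationalSGNE (G : SGDG Ω N T ns m n) (u : ProfileSpace N T n) : Prop :=
  G.IsSGNE u ∧ u ∈ G.sviSolutions

/-- The matrix `∇_u g(s_0, u, w)` of partial derivatives (column `j` stacks the partial gradients
`∇_{u^i} g^j`), as a linear map `ℝ^m → ℝ^{T ∑ n_i}`; its norm is the induced 2-norm. -/
def gradCon (G : SGDG Ω N T ns m n) (u : ProfileSpace N T n) (ω : Ω) :
    EuclideanSpace ℝ (Fin m) →L[ℝ] ProfileSpace N T n :=
  ∑ j, (EuclideanSpace.proj j : EuclideanSpace ℝ (Fin m) →L[ℝ] ℝ).smulRight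
    (WithLp.toLp 2 (fun i => gradient (fun v => G.g (deviate u i v) ω j) (u i)))

/-- Assumption on the costs: they are well defined, the state parts are convex and
differentiable, the strategy parts are continuous in the profile, and convex and differentiable in
the player's own strategy. -/
structure CostAssumption (G : SGDG Ω N T ns m n) : Prop where
  wellDefined : ∀ i u, Integrable (fun ω => G.cost i u ω) G.P
  convex_state : ∀ i, ConvexOn ℝ Set.univ (G.costState i)
  differentiable_state : ∀ i, Differentiable ℝ (G.costState i)
  continuous_strat : ∀ i, Continuous (G.costStrat i)
  convex_strat : ∀ i u, ConvexOn ℝ Set.univ (fun v => G.costStrat i (deviate u i v))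
  differentiable_strat : ∀ i u, Differentiable ℝ (fun v => G.costStrat i (deviate u i v))

/-- Assumption on the constraint functions: the state parts are convex and differentiable, the
strategy parts are convex and differentiable in every player's own strategy. -/
structure ConstraintAssumption (G : SGDG Ω N T ns m n) : Prop where
  convex_state : ∀ j, ConvexOn ℝ Set.univ (G.conState j)
  differentiable_state : ∀ j, Differentiable ℝ (G.conState j)
  convex_strat : ∀ j i u, ConvexOn ℝ Set.univ (fun v => G.conStrat j (deviate u i v))
  differentiable_strat : ∀ j i u, Differentiable ℝ (fun v => G.conStrat j (deviate u i v))

/-- Concentration of measure for a class `C` of (integrable) functions of the noise, with the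
decreasing function `h : ℝ≥0 → [0, 1]`; the constraint functions belong to `C`, and `h` falls to
the levels `γ^j`, so that `h⁻¹(γ^j)` exists. -/
structure ConcentrationAssumption (G : SGDG Ω N T ns m n) (C : Set (Ω → ℝ)) : Prop where
  antitone_h : Antitone G.h
  h_mem : ∀ θ, G.h θ ∈ Set.Icc (0 : ℝ) 1
  integrable : ∀ φ ∈ C, Integrable φ G.P
  concentration : ∀ φ ∈ C, ∀ θ : ℝ≥0,
    1 - G.h θ ≤ G.P.real {ω | |φ ω - ∫ ω', φ ω' ∂G.P| ≤ θ}
  con_mem : ∀ j, ∀ u ∈ G.profileSet, (fun ω => G.con j u ω) ∈ C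
  exists_h_le : ∀ j, ∃ θ, G.h θ ≤ G.γ j

/-- Slater's constraint qualification for the constraint system `u ∈ K`, `f j u ≤ 0`: the
constraint functions are convex on `K` and some point of `K` satisfies all constraints strictly. -/
structure SlaterCQ {E : Type*} [AddCommGroup E] [Module ℝ E] {ι : Type*}
    (K : Set E) (f : ι → E → ℝ) : Prop where
  convexOn : ∀ j, ConvexOn ℝ K (f j)
  exists_strict : ∃ u ∈ K, ∀ j, f j u < 0

/-- Slater's condition for the under-approximated feasible set, and Lipschitz continuity and
boundedness of `g`, `∇_u g` and the costs with integrable constants. -/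
structure RegularityAssumption (G : SGDG Ω N T ns m n) : Prop where
  slater : SlaterCQ G.profileSet G.expCon
  lipschitz_g : ∃ ℓ : Ω → ℝ, Integrable ℓ G.P ∧ ∀ ω, ∀ u ∈ G.profileSet, ∀ v ∈ G.profileSet,
    ‖G.g u ω - G.g v ω‖ ≤ ℓ ω * ‖u - v‖
  bounded_g : ∃ b : Ω → ℝ, Integrable b G.P ∧ ∀ ω, ∀ u ∈ G.feasibleSet, ‖G.g u ω‖ ≤ b ω
  bounded_gradCon : ∃ b : Ω → ℝ, Integrable b G.P ∧
    ∀ ω, ∀ u ∈ G.feasibleSet, ‖G.gradCon u ω‖ ≤ b ω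
  lipschitz_cost : ∀ i, ∀ u ∈ G.profileSet, ∃ ℓ : Ω → ℝ, Integrable ℓ G.P ∧
    ∀ ω, ∀ v ∈ G.localSet i, ∀ v' ∈ G.localSet i,
      |G.cost i (deviate u i v) ω - G.cost i (deviate u i v') ω| ≤ ℓ ω * ‖v - v'‖

end SGDG

end

/-! The feasible set is nonempty by the Slater point, convex because the expected constraints are
convex, and compact because the integrable Lipschitz constant makes them continuous on the compact
set of profiles. Once the pseudo-gradient is known to be continuous, the Hartman–Stampacchia theorem
solves the variational inequality. Testing a solution against a unilateral deviation leaves one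
block of the inner product, and the subgradient inequality for that player's expected cost turns it
into the Nash inequality.

Continuity of the pseudo-gradient needs no joint smoothness of the costs
(`continuous_of_subgradient`). Each block is both a subgradient and a directional derivative of the
expected cost in the player's own strategy, hence bounded above by difference quotients that
converge to it. The expected cost is jointly continuous, so the derivative along `e` is upper
semicontinuous; the direction `-e` gives lower semicontinuity.

Hartman–Stampacchia is Brouwer's theorem for `x ↦ p (x - F x)`, `p` the metric projection. Brouwer
follows from the absence of a retraction `x + g x` onto the sphere: for small `t` the map `x + t g
x` permutes the ball, so the integral of its Jacobian is the volume of the ball; this integral is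
polynomial in `t`, yet vanishes at `t = 1`. -/

/-! ### Determinants of perturbations of the identity. -/

section Determinant

open Polynomial in
/-- `t ↦ det (1 + t A)` is a polynomial of degree at most the dimension. -/
theorem exists_polynomial_eval_eq_det_one_add_smul {E : Type*} [AddCommGroup E] [Module ℝ E]
    [FiniteDimensional ℝ E] (A : E →ₗ[ℝ] E) :
    ∃ p : ℝ[X], p.natDegree ≤ Module.finrank ℝ E ∧
      ∀ t : ℝ, p.eval t = LinearMap.det (1 + t • A) := by
  let b := Module.finBasis ℝ E
  let M := LinearMap.toMatrix b b A
  refine ⟨((X : ℝ[X]) • M.map C + (1 : Matrix _ _ ℝ).map C).det, ?_, fun t => ?_⟩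
  · simpa using natDegree_det_X_add_C_le M 1
  · rw [← coe_evalRingHom, RingHom.map_det, ← LinearMap.det_toMatrix b]
    congr 1
    ext i j
    rcases eq_or_ne i j with rfl | hij
    · simp [M, LinearMap.toMatrix_one]
      ring
    · simp [M, LinearMap.toMatrix_one, hij]
      ring

/-- Interpolation of `t ↦ det (1 + t A)` at `t = 1`. -/
theorem det_one_add_eq_sum_lagrange {E : Type*} [AddCommGroup E] [Module ℝ E]
    [FiniteDimensional ℝ E] (A : E →ₗ[ℝ] E) {s : Finset ℕ} {t : ℕ → ℝ}
    (ht : Set.InjOn t s) (hs : Module.finrank ℝ E < s.card) :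
    LinearMap.det (1 + A) =
      ∑ k ∈ s, LinearMap.det (1 + t k • A) * (Lagrange.basis s t k).eval 1 := by
  obtain ⟨p, hp, hpe⟩ := exists_polynomial_eval_eq_det_one_add_smul A
  have hdeg : p.degree < s.card :=
    lt_of_le_of_lt Polynomial.degree_le_natDegree (by exact_mod_cast lt_of_le_of_lt hp hs)
  have h1 := hpe 1
  rw [one_smul] at h1
  rw [← h1, Lagrange.eq_interpolate ht hdeg, Lagrange.interpolate_apply,
    Polynomial.eval_finsetSum]
  simp [hpe]

/-- By the Neumann series the determinant has no zero on `[0, t]`, and it equals 1 at 0; the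
intermediate value theorem fixes its sign. -/
theorem det_one_add_smul_pos {E : Type*} [NormedAddCommGroup E] [NormedSpace ℝ E]
    [FiniteDimensional ℝ E] (A : E →L[ℝ] E) {t : ℝ} (ht : 0 ≤ t) (htA : t * ‖A‖ < 1) :
    0 < (1 + t • A).det := by
  have hcont : Continuous fun s : ℝ => (1 + s • A).det :=
    ContinuousLinearMap.continuous_det.comp (by fun_prop)
  have hne : ∀ s ∈ Set.Icc 0 t, (1 + s • A).det ≠ 0 := by
    intro s hs
    have hn : ‖-(s • A)‖ < 1 := by
      rw [norm_neg, norm_smul, Real.norm_of_nonneg hs.1]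
      exact lt_of_le_of_lt (mul_le_mul_of_nonneg_right hs.2 (norm_nonneg A)) htA
    have hu := isUnit_one_sub_of_norm_lt_one hn
    rw [sub_neg_eq_add] at hu
    have h2 : IsUnit ((1 + s • A : E →L[ℝ] E) : E →ₗ[ℝ] E) :=
      hu.map (ContinuousLinearMap.toLinearMapRingHom (R₁ := ℝ) (M₁ := E))
    exact ((LinearMap.isUnit_iff_isUnit_det _).1 h2).ne_zero
  by_contra hcon
  have h0 : (0 : ℝ) ∈ Set.Icc ((1 + t • A).det) ((1 + (0 : ℝ) • A).det) := by
    refine ⟨not_lt.1 hcon, ?_⟩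
    simp [ContinuousLinearMap.det]
  obtain ⟨s, hs, hs0⟩ := intermediate_value_Icc' ht hcont.continuousOn h0
  exact hne s hs hs0

end Determinant

/-! ### Lipschitz perturbations of the identity. -/

section Perturbation

variable {E : Type*} [NormedAddCommGroup E] [NormedSpace ℝ E]

theorem injective_add_smul_of_lipschitz {g : E → E} {K : ℝ≥0} (hg : LipschitzWith K g)
    {t : ℝ} (ht : 0 ≤ t) (htK : t * K < 1) : Function.Injective fun x => x + t • g x := by
  intro x y hxy
  have h1 : x - y = t • (g y - g x) := by
    rw [smul_sub, sub_eq_sub_iff_add_eq_add, add_comm (t • g y)]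
    exact hxy
  by_contra hne
  have hpos : 0 < ‖x - y‖ := norm_pos_iff.2 (sub_ne_zero.2 hne)
  have h2 : ‖x - y‖ ≤ t * K * ‖x - y‖ := by
    conv_lhs => rw [h1, norm_smul, Real.norm_of_nonneg ht]
    rw [mul_assoc, norm_sub_rev x y]
    exact mul_le_mul_of_nonneg_left (by simpa [dist_eq_norm] using hg.dist_le_mul y x) ht
  nlinarith

theorem surjective_add_smul_of_lipschitz [CompleteSpace E] {g : E → E} {K : ℝ≥0}
    (hg : LipschitzWith K g) {t : ℝ} (ht : 0 ≤ t) (htK : t * K < 1) :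
    Function.Surjective fun x => x + t • g x := by
  intro y
  have hc : ContractingWith (t.toNNReal * K) fun x => y - t • g x := by
    refine ⟨by rw [← NNReal.coe_lt_coe]; simpa [ht] using htK, LipschitzWith.of_dist_le_mul fun a b => ?_⟩
    rw [dist_sub_left, dist_smul₀, Real.norm_of_nonneg ht]
    rw [NNReal.coe_mul, Real.coe_toNNReal t ht, mul_assoc]
    exact mul_le_mul_of_nonneg_left (hg.dist_le_mul a b) ht
  refine ⟨hc.fixedPoint, ?_⟩
  have := hc.fixedPoint_isFixedPt
  exact (eq_sub_iff_add_eq.1 this.symm)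

/-- The perturbed map is a bijection of the whole space and the identity off the ball, so it must
permute the ball. -/
theorem image_ball_add_smul_of_lipschitz [CompleteSpace E] {g : E → E} {K : ℝ≥0}
    (hg : LipschitzWith K g) (hg0 : ∀ x ∉ Metric.ball (0 : E) 1, g x = 0) {t : ℝ} (ht : 0 ≤ t)
    (htK : t * K < 1) :
    (fun x => x + t • g x) '' Metric.ball 0 1 = Metric.ball 0 1 := by
  apply Set.Subset.antisymm
  · rintro _ ⟨x, hx, rfl⟩
    by_contra hy
    have hxy := injective_add_smul_of_lipschitz hg ht htK
      (a₁ := x + t • g x) (a₂ := x) (by simp [hg0 _ hy])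
    exact hy (by simpa [hxy] using hx)
  · intro y hy
    obtain ⟨x, rfl⟩ := surjective_add_smul_of_lipschitz hg ht htK y
    refine ⟨x, ?_, rfl⟩
    by_contra hx
    exact hx (by simpa [hg0 x hx] using hy)

end Perturbation

/-! ### No retraction of the ball onto the sphere. -/

section Retraction

variable {E : Type*} [NormedAddCommGroup E] [InnerProductSpace ℝ E] [FiniteDimensional ℝ E]

/-- Differentiating `‖f‖² = 1` puts the range of `f'` in the orthogonal complement of `f x ≠ 0`, so
`f'` is not surjective. -/
theorem det_eq_zero_of_norm_eq_one {f : E → E} {f' : E →L[ℝ] E} {x : E}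
    (hf : HasFDerivAt f f' x) (hn : ∀ᶠ y in nhds x, ‖f y‖ = 1) : f'.det = 0 := by
  have h1 : HasFDerivAt (fun y => ‖f y‖ ^ 2) _ x := hf.norm_sq
  have h2 : HasFDerivAt (fun y => ‖f y‖ ^ 2) (0 : E →L[ℝ] ℝ) x :=
    (hasFDerivAt_const (1 : ℝ) x).congr_of_eventuallyEq (hn.mono fun y hy => by simp [hy])
  have h3 := h1.unique h2
  have h4 : ∀ v, inner ℝ (f x) (f' v) = 0 := fun v => by
    have := congrArg (fun L : E →L[ℝ] ℝ => L v) h3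
    simpa using this
  by_contra hdet
  have hu : IsUnit (f' : E →ₗ[ℝ] E) :=
    (LinearMap.isUnit_iff_isUnit_det _).2 (isUnit_iff_ne_zero.2 hdet)
  obtain ⟨v, hv⟩ := ((Module.End.isUnit_iff _).1 hu).2 (f x)
  have h5 := h4 v
  have hv' : f' v = f x := hv
  rw [hv', real_inner_self_eq_norm_sq, hn.self_of_nhds] at h5
  norm_num at h5

/-- There is no Lipschitz retraction of the ball onto the sphere that is differentiable inside. -/
theorem not_exists_lipschitz_retraction {g : E → E} {K : ℝ≥0} (hg : LipschitzWith K g)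
    (hg0 : ∀ x ∉ Metric.ball (0 : E) 1, g x = 0)
    (hd : ∀ x ∈ Metric.ball (0 : E) 1, DifferentiableAt ℝ g x)
    (hn : ∀ x ∈ Metric.ball (0 : E) 1, ‖x + g x‖ = 1) : False := by
  borelize E
  let μ : Measure E := Measure.addHaar
  let B := Metric.ball (0 : E) 1
  -- The determinant has degree at most the dimension in `t`, so dimension + 1 distinct nodes
  -- determine it; the factor `1 / (K + 1)` puts every node in the range `t * K < 1`.
  let s := Finset.range (Module.finrank ℝ E + 1)
  let t : ℕ → ℝ := fun k => 1 / ((K + 1) * (k + 1))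
  have ht0 : ∀ k, 0 < t k := fun k => by positivity
  have htK : ∀ k, t k * K < 1 := by
    intro k
    have hK : (0 : ℝ) ≤ K := K.2
    have hk : (0 : ℝ) ≤ k := k.cast_nonneg
    rw [div_mul_eq_mul_div, one_mul, div_lt_one (by positivity)]
    nlinarith
  have htinj : Set.InjOn t s := by
    intro a _ b _ hab
    have hK : ((K : ℝ) + 1) ≠ 0 := by positivity
    simp only [t] at hab
    field_simp at hab
    exact_mod_cast (by linarith : (a : ℝ) = b)
  have hpos : ∀ k x, 0 < (1 + t k • fderiv ℝ g x).det := fun k x =>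
    det_one_add_smul_pos _ (ht0 k).le (lt_of_le_of_lt
      (mul_le_mul_of_nonneg_left (norm_fderiv_le_of_lipschitz ℝ hg) (ht0 k).le) (htK k))
  have hder : ∀ k, ∀ x ∈ B, HasFDerivWithinAt (fun x => x + t k • g x)
      (1 + t k • fderiv ℝ g x) B x := fun k x hx =>
    ((hasFDerivAt_id x).add ((hd x hx).hasFDerivAt.const_smul (t k))).hasFDerivWithinAt
  have hinj : ∀ k, Set.InjOn (fun x => x + t k • g x) B := fun k =>
    (injective_add_smul_of_lipschitz hg (ht0 k).le (htK k)).injOn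
  have himg : ∀ k, (fun x => x + t k • g x) '' B = B := fun k =>
    image_ball_add_smul_of_lipschitz hg hg0 (ht0 k).le (htK k)
  have hfin : μ B ≠ ⊤ := measure_ball_lt_top.ne
  have hint : ∀ k, IntegrableOn (fun x => (1 + t k • fderiv ℝ g x).det) B μ := by
    intro k
    have h := (integrableOn_image_iff_integrableOn_abs_det_fderiv_smul μ
      Metric.isOpen_ball.measurableSet (hder k) (hinj k) (fun _ => (1 : ℝ))).1
      (by rw [himg k]; exact integrableOn_const hfin)
    simpa [abs_of_pos (hpos k _)] using h
  -- Change of variables: the Jacobian integrates to the volume of the image, which is the ball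
  -- itself.
  have hval : ∀ k, ∫ x in B, (1 + t k • fderiv ℝ g x).det ∂μ = μ.real B := by
    intro k
    have h := integral_image_eq_integral_abs_det_fderiv_smul μ
      Metric.isOpen_ball.measurableSet (hder k) (hinj k) (fun _ => (1 : ℝ))
    rw [himg k] at h
    simpa [abs_of_pos (hpos k _)] using h.symm
  -- The Jacobian at `t = 1`, zero by `det_eq_zero_of_norm_eq_one`, written through its values at
  -- the small nodes. Integrating gives the volume of the ball times the sum of the weights, which
  -- is 1.
  have hzero : ∀ x ∈ B, ∑ k ∈ s, (1 + t k • fderiv ℝ g x).det *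
      (Lagrange.basis s t k).eval 1 = 0 := by
    intro x hx
    have h1 : (1 + fderiv ℝ g x).det = 0 :=
      det_eq_zero_of_norm_eq_one (f := fun x => x + g x) (x := x)
        ((hasFDerivAt_id x).add (hd x hx).hasFDerivAt)
        ((Metric.isOpen_ball.eventually_mem hx).mono hn)
    exact (det_one_add_eq_sum_lagrange (fderiv ℝ g x : E →ₗ[ℝ] E) htinj
      (by simp [s])).symm.trans h1
  have hsum : ∑ k ∈ s, (Lagrange.basis s t k).eval 1 = 1 := by
    rw [← Polynomial.eval_finsetSum, Lagrange.sum_basis htinj (by simp [s])]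
    simp
  have h0 : ∫ x in B, ∑ k ∈ s, (1 + t k • fderiv ℝ g x).det *
      (Lagrange.basis s t k).eval 1 ∂μ = 0 :=
    setIntegral_eq_zero_of_forall_eq_zero hzero
  rw [integral_finsetSum _ fun k _ => (hint k).mul_const _] at h0
  simp_rw [integral_mul_const, hval, ← Finset.mul_sum] at h0
  rw [hsum, mul_one] at h0
  have : 0 < μ.real B := ENNReal.toReal_pos (Metric.measure_ball_pos μ 0 one_pos).ne' hfin
  exact this.ne' h0

end Retraction

/-! ### Metric projection and the ray from `f x` through `x`. -/

section Projection

variable {E : Type*} [NormedAddCommGroup E] [InnerProductSpace ℝ E]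

/-- The metric projection onto a nonempty complete convex set. -/
theorem exists_convex_projection {K : Set E} (hne : K.Nonempty) (hK : IsComplete K)
    (hc : Convex ℝ K) :
    ∃ p : E → E, LipschitzWith 1 p ∧ (∀ x, p x ∈ K) ∧
      ∀ x, ∀ y ∈ K, inner ℝ (x - p x) (y - p x) ≤ 0 := by
  choose p hpK hp using fun x => exists_norm_eq_iInf_of_complete_convex hne hK hc x
  have hin : ∀ x, ∀ y ∈ K, inner ℝ (x - p x) (y - p x) ≤ 0 := fun x =>
    (norm_eq_iInf_iff_real_inner_le_zero hc (hpK x)).1 (hp x)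
  refine ⟨p, LipschitzWith.of_dist_le_mul fun x y => ?_, hpK, hin⟩
  rw [NNReal.coe_one, one_mul, dist_eq_norm, dist_eq_norm]
  have h1 := hin x (p y) (hpK y)
  have h2 := hin y (p x) (hpK x)
  -- Firm nonexpansiveness, the sum of the two obtuse-angle inequalities; Cauchy–Schwarz then gives
  -- constant 1.
  have h3 : ‖p x - p y‖ ^ 2 ≤ inner ℝ (x - y) (p x - p y) := by
    rw [← real_inner_self_eq_norm_sq]
    have : inner ℝ (x - y) (p x - p y) - inner ℝ (p x - p y) (p x - p y) =
        -(inner ℝ (x - p x) (p y - p x) + inner ℝ (y - p y) (p x - p y)) := by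
      simp only [inner_sub_left, inner_sub_right]
      ring
    linarith
  have h4 := real_inner_le_norm (x - y) (p x - p y)
  by_contra! h
  nlinarith [norm_nonneg (x - y), norm_nonneg (p x - p y)]

/-- The coefficient `c ≥ 0` for which `x + c (x - f x)` lies on the unit sphere. -/
noncomputable def rayCoeff (f : E → E) (x : E) : ℝ :=
  (-inner ℝ x (x - f x) + √(inner ℝ x (x - f x) ^ 2 + ‖x - f x‖ ^ 2 * (1 - ‖x‖ ^ 2))) /
    ‖x - f x‖ ^ 2

/-- On the sphere the last term vanishes, but `2⟨x, x - f x⟩ = ‖x - f x‖² + 1 - ‖f x‖² > 0`.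
Strictness up to the boundary keeps the square root smooth there. -/
theorem rayCoeff_discriminant_pos {f : E → E} {x : E} (hx : ‖x‖ ≤ 1) (hfx : ‖f x‖ ≤ 1)
    (hne : f x ≠ x) :
    0 < inner ℝ x (x - f x) ^ 2 + ‖x - f x‖ ^ 2 * (1 - ‖x‖ ^ 2) := by
  have ha : 0 < ‖x - f x‖ ^ 2 := pow_pos (norm_pos_iff.2 (sub_ne_zero.2 hne.symm)) 2
  rcases hx.lt_or_eq with h | h
  · have : 0 < 1 - ‖x‖ ^ 2 := by nlinarith [norm_nonneg x]
    positivity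
  · have hb : 0 < inner ℝ x (x - f x) := by
      have h1 := norm_sub_sq_real x (f x)
      have h2 : inner ℝ x (x - f x) = 1 - inner ℝ x (f x) := by
        rw [inner_sub_right, real_inner_self_eq_norm_sq, h, one_pow]
      rw [h] at h1
      nlinarith [norm_nonneg (f x)]
    rw [h]
    nlinarith

theorem rayCoeff_eq_zero {f : E → E} {x : E} (hx : ‖x‖ = 1) (hfx : ‖f x‖ ≤ 1) :
    rayCoeff f x = 0 := by
  have hb : 0 ≤ inner ℝ x (x - f x) := by
    rw [inner_sub_right, real_inner_self_eq_norm_sq, hx]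
    have := real_inner_le_norm x (f x)
    rw [hx] at this
    linarith
  simp [rayCoeff, hx, Real.sqrt_sq hb]

theorem norm_add_rayCoeff_smul {f : E → E} {x : E} (hx : ‖x‖ ≤ 1) (hfx : ‖f x‖ ≤ 1)
    (hne : f x ≠ x) : ‖x + rayCoeff f x • (x - f x)‖ = 1 := by
  have ha : 0 < ‖x - f x‖ ^ 2 := pow_pos (norm_pos_iff.2 (sub_ne_zero.2 hne.symm)) 2
  have hs := Real.sq_sqrt (rayCoeff_discriminant_pos hx hfx hne).le
  have h1 : ‖x + rayCoeff f x • (x - f x)‖ ^ 2 = 1 := by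
    rw [norm_add_sq_real, real_inner_smul_right, norm_smul, mul_pow, Real.norm_eq_abs, sq_abs]
    have hr : rayCoeff f x * ‖x - f x‖ ^ 2 + inner ℝ x (x - f x) =
        √(inner ℝ x (x - f x) ^ 2 + ‖x - f x‖ ^ 2 * (1 - ‖x‖ ^ 2)) := by
      rw [rayCoeff, div_mul_cancel₀ _ ha.ne']
      ring
    rw [← hr] at hs
    have : ‖x - f x‖ ^ 2 * (‖x‖ ^ 2 + 2 * (rayCoeff f x * inner ℝ x (x - f x)) +
        rayCoeff f x ^ 2 * ‖x - f x‖ ^ 2 - 1) = 0 := by linear_combination hs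
    rcases mul_eq_zero.1 this with h | h
    · exact absurd h ha.ne'
    · linarith
  exact (pow_eq_one_iff_of_nonneg (norm_nonneg _) two_ne_zero).1 h1

theorem contDiffAt_rayCoeff {f : E → E} (hf : ContDiff ℝ 1 f) {x : E} (hx : ‖x‖ ≤ 1)
    (hfx : ‖f x‖ ≤ 1) (hne : f x ≠ x) : ContDiffAt ℝ 1 (rayCoeff f) x := by
  have h1 : ContDiff ℝ 1 fun x => x - f x := contDiff_id.sub hf
  have h2 : ContDiff ℝ 1 fun x => inner ℝ x (x - f x) := contDiff_id.inner ℝ h1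
  have h3 : ContDiff ℝ 1 fun x => ‖x - f x‖ ^ 2 := h1.norm_sq ℝ
  have h4 : ContDiff ℝ 1 fun x : E => 1 - ‖x‖ ^ 2 := contDiff_const.sub (contDiff_id.norm_sq ℝ)
  refine ((h2.contDiffAt.neg).add (ContDiffAt.sqrt ?_
    (rayCoeff_discriminant_pos hx hfx hne).ne')).div h3.contDiffAt ?_
  · exact ((h2.pow 2).add (h3.mul h4)).contDiffAt
  · exact (pow_pos (norm_pos_iff.2 (sub_ne_zero.2 hne.symm)) 2).ne'

end Projection

/-! ### Brouwer's theorem and variational inequalities. -/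

section Brouwer

variable {E : Type*} [NormedAddCommGroup E] [InnerProductSpace ℝ E] [FiniteDimensional ℝ E]

/-- **Brouwer's theorem** for continuously differentiable self-maps of the unit ball. -/
theorem exists_fixedPoint_closedBall_of_contDiff {f : E → E} (hf : ContDiff ℝ 1 f)
    (hB : ∀ x, ‖x‖ ≤ 1 → ‖f x‖ ≤ 1) : ∃ x, ‖x‖ ≤ 1 ∧ f x = x := by
  by_contra! hne
  let g : E → E := fun x => rayCoeff f x • (x - f x)
  have hg1 : ∀ x, ‖x‖ ≤ 1 → ContDiffAt ℝ 1 g x := fun x hx =>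
    (contDiffAt_rayCoeff hf hx (hB x hx) (hne x hx)).smul (contDiff_id.sub hf).contDiffAt
  obtain ⟨K, hK⟩ := ContDiffOn.exists_lipschitzOnWith (s := Metric.closedBall (0 : E) 1)
    (fun x hx => (hg1 x (by simpa using hx)).contDiffWithinAt) one_ne_zero
    (convex_closedBall 0 1) (isCompact_closedBall 0 1)
  -- Composing with the projection onto the ball extends `g` to a globally Lipschitz map; outside
  -- the open ball the projection lands on the sphere, where `rayCoeff` vanishes.
  obtain ⟨p, hpL, hpB, hp⟩ := exists_convex_projection (K := Metric.closedBall (0 : E) 1)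
    ⟨0, by simp⟩ Metric.isClosed_closedBall.isComplete (convex_closedBall 0 1)
  have hpid : ∀ x ∈ Metric.closedBall (0 : E) 1, p x = x := fun x hx => by
    have h := hp x x hx
    rw [real_inner_self_eq_norm_sq] at h
    have : ‖x - p x‖ = 0 := by nlinarith [norm_nonneg (x - p x)]
    exact (sub_eq_zero.1 (norm_eq_zero.1 this)).symm
  have hgp : ∀ x ∈ Metric.ball (0 : E) 1, (fun x => g (p x)) =ᶠ[nhds x] g := fun x hx =>
    (Metric.isOpen_ball.eventually_mem hx).mono fun y hy => by
      simp only [hpid y (Metric.ball_subset_closedBall hy)]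
  refine not_exists_lipschitz_retraction (g := fun x => g (p x)) (K := K * 1) ?_ ?_ ?_ ?_
  · exact lipschitzOnWith_univ.1 (hK.comp hpL.lipschitzOnWith fun x _ => hpB x)
  · intro x hx
    have hx1 : 1 ≤ ‖x‖ := by simpa using hx
    have hpx : ‖p x‖ ≤ 1 := by simpa using hpB x
    have hp1 : ‖p x‖ = 1 := by
      refine le_antisymm hpx (not_lt.1 fun hlt => ?_)
      have hxp : x ≠ p x := fun h => by rw [← h] at hlt; linarith
      have hpos : 0 < ‖x - p x‖ := norm_pos_iff.2 (sub_ne_zero.2 hxp)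
      -- Moving from `p x` towards `x` by the slack `1 - ‖p x‖` stays in the ball, against the
      -- obtuse-angle inequality.
      let c : ℝ := (1 - ‖p x‖) / ‖x - p x‖
      have hc : 0 < c := div_pos (sub_pos.2 hlt) hpos
      have hmem : p x + c • (x - p x) ∈ Metric.closedBall (0 : E) 1 := by
        rw [mem_closedBall_zero_iff]
        refine (norm_add_le _ _).trans ?_
        rw [norm_smul, Real.norm_of_nonneg hc.le, div_mul_cancel₀ _ hpos.ne']
        linarith
      have h := hp x _ hmem
      rw [add_sub_cancel_left, real_inner_smul_right, real_inner_self_eq_norm_sq] at h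
      have : 0 < c * ‖x - p x‖ ^ 2 := by positivity
      linarith
    simp [g, rayCoeff_eq_zero hp1 (hB _ hpx)]
  · intro x hx
    exact ((hg1 x (by simpa using (Metric.ball_subset_closedBall hx))).differentiableAt
      one_ne_zero).congr_of_eventuallyEq (hgp x hx)
  · intro x hx
    have hx1 : ‖x‖ ≤ 1 := by simpa using Metric.ball_subset_closedBall hx
    rw [hpid x (Metric.ball_subset_closedBall hx)]
    exact norm_add_rayCoeff_smul hx1 (hB x hx1) (hne x hx1)

open scoped Manifold in
/-- **Brouwer's theorem** for the unit ball. -/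
theorem exists_fixedPoint_closedBall {f : E → E} (hf : Continuous f) (hB : ∀ x, ‖f x‖ ≤ 1) :
    ∃ x, ‖x‖ ≤ 1 ∧ f x = x := by
  by_contra! hne
  have hcompact : IsCompact (Metric.closedBall (0 : E) 1) := isCompact_closedBall 0 1
  obtain ⟨x₀, hx₀, hmin⟩ := hcompact.exists_isMinOn ⟨0, by simp⟩
    (continuous_norm.comp (hf.sub continuous_id)).continuousOn
  have hε : 0 < ‖f x₀ - x₀‖ :=
    norm_pos_iff.2 (sub_ne_zero.2 (hne x₀ (by simpa using hx₀)))
  -- A smooth partition of unity yields a C¹ self-map of the ball closer to `f` than the least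
  -- displacement of `f`, so its fixed point is moved too little by `f`.
  obtain ⟨φ, hφ⟩ := exists_contMDiffMap_forall_mem_convex_of_local_const 𝓘(ℝ, E) (n := 1)
    (t := fun x => Metric.ball (f x) ‖f x₀ - x₀‖ ∩ Metric.closedBall 0 1)
    (fun x => (convex_ball _ _).inter (convex_closedBall _ _)) (fun x => ⟨f x, by
      have : ∀ᶠ y in nhds x, dist (f x) (f y) < ‖f x₀ - x₀‖ :=
        (continuous_const.dist hf).continuousAt.eventually_lt continuousAt_const
          (by simpa only [dist_self] using hε)
      exact this.mono fun y hy => ⟨hy, by simpa using hB x⟩⟩)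
  obtain ⟨x, hx, hfix⟩ := exists_fixedPoint_closedBall_of_contDiff (f := φ) φ.contMDiff.contDiff
    fun x _ => by simpa using (hφ x).2
  have h1 := (hφ x).1
  rw [hfix, Metric.mem_ball, dist_comm, dist_eq_norm] at h1
  exact absurd (isMinOn_iff.1 hmin x (by simpa using hx)) (not_le.2 h1)

/-- **Hartman–Stampacchia**: a continuous map on a nonempty compact convex set has a solution of
its variational inequality. -/
theorem exists_variationalInequality_solution {K : Set E} (hne : K.Nonempty) (hK : IsCompact K)
    (hc : Convex ℝ K) {F : E → E} (hF : ContinuousOn F K) :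
    ∃ x ∈ K, ∀ y ∈ K, 0 ≤ inner ℝ (F x) (y - x) := by
  obtain ⟨p, hpL, hpK, hp⟩ := exists_convex_projection hne hK.isComplete hc
  obtain ⟨R, hR0, hR⟩ := hK.isBounded.exists_pos_norm_le
  have hFp : Continuous fun x => F (p x) :=
    hF.comp_continuous hpL.continuous hpK
  -- The inner `p` makes the map continuous on the whole space, with `F` evaluated only on `K`;
  -- scaling by `R` transfers it to the unit ball.
  let T : E → E := fun z => p (p (R • z) - F (p (R • z)))
  have hT : Continuous T := hpL.continuous.comp
    ((hpL.continuous.sub hFp).comp (continuous_const_smul R))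
  obtain ⟨z, -, hz⟩ := exists_fixedPoint_closedBall (f := fun z => R⁻¹ • T z)
    (hT.const_smul _) (fun z => by
      rw [norm_smul, norm_inv, Real.norm_of_nonneg hR0.le, inv_mul_le_one₀ hR0]
      exact hR _ (hpK _))
  have hTz : T z = R • z := by
    rw [← hz, smul_smul, mul_inv_cancel₀ hR0.ne', one_smul, hz]
  let x := T z
  have hxK : x ∈ K := hpK _
  have hpx : p x = x := by
    have h := hp x x hxK
    rw [real_inner_self_eq_norm_sq] at h
    have : ‖x - p x‖ = 0 := by nlinarith [norm_nonneg (x - p x)]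
    exact (sub_eq_zero.1 (norm_eq_zero.1 this)).symm
  have hx : p (x - F x) = x := by
    have : p (p (R • z) - F (p (R • z))) = x := rfl
    rwa [← hTz, hpx] at this
  refine ⟨x, hxK, fun y hy => ?_⟩
  have h := hp (x - F x) y hy
  rw [hx, sub_sub_cancel_left, inner_neg_left] at h
  linarith

end Brouwer

/-! ### Convex difference quotients and gradients. -/

section ConvexSlope

variable {V : Type*} [AddCommGroup V] [Module ℝ V]

theorem ConvexOn.comp_add_smul {f : V → ℝ} (hc : ConvexOn ℝ Set.univ f) (v e : V) :
    ConvexOn ℝ Set.univ fun t : ℝ => f (v + t • e) := by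
  simpa [Function.comp_def, AffineMap.lineMap_apply, add_comm] using
    hc.comp_affineMap (AffineMap.lineMap v (v + e) : ℝ →ᵃ[ℝ] V)

theorem ConvexOn.slope_le_of_le_one {f : V → ℝ} (hc : ConvexOn ℝ Set.univ f) (v e : V)
    {t : ℝ} (ht : 0 < t) (ht1 : t ≤ 1) : t⁻¹ * (f (v + t • e) - f v) ≤ f (v + e) - f v := by
  have h := hc.2 (Set.mem_univ v) (Set.mem_univ (v + e)) (sub_nonneg.2 ht1) ht.le (by ring)
  have hv : (1 - t) • v + t • (v + e) = v + t • e := by module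
  rw [hv, smul_eq_mul, smul_eq_mul] at h
  rw [inv_mul_le_iff₀ ht]
  linarith

end ConvexSlope

section ConvexGradient

variable {V : Type*} [NormedAddCommGroup V] [InnerProductSpace ℝ V] [CompleteSpace V]

theorem hasDerivAt_comp_add_smul {f : V → ℝ} {v : V}
    (hf : DifferentiableAt ℝ f v) (e : V) :
    HasDerivAt (fun t : ℝ => f (v + t • e)) (inner ℝ (gradient f v) e) 0 := by
  have h1 : HasDerivAt (fun t : ℝ => v + t • e) e 0 := by
    simpa using ((hasDerivAt_id (0 : ℝ)).smul_const e).const_add v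
  have h2 : HasFDerivAt f (InnerProductSpace.toDual ℝ V (gradient f v)) (v + (0 : ℝ) • e) := by
    simpa using hf.hasGradientAt.hasFDerivAt
  simpa [Function.comp_def] using h2.comp_hasDerivAt (0 : ℝ) h1

/-- The gradient of a convex function is a subgradient, in terms of difference quotients. -/
theorem ConvexOn.inner_gradient_le_slope {f : V → ℝ} (hc : ConvexOn ℝ Set.univ f) {v : V}
    (hf : DifferentiableAt ℝ f v) (e : V) {t : ℝ} (ht : 0 < t) :
    inner ℝ (gradient f v) e ≤ t⁻¹ * (f (v + t • e) - f v) := by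
  have h := (hc.comp_add_smul v e).le_slope_of_hasDerivAt (Set.mem_univ 0) (Set.mem_univ t) ht
    (hasDerivAt_comp_add_smul hf e)
  simpa [slope_def_field, div_eq_inv_mul] using h

theorem ConvexOn.inner_gradient_le {f : V → ℝ} (hc : ConvexOn ℝ Set.univ f) {v : V}
    (hf : DifferentiableAt ℝ f v) (e : V) : inner ℝ (gradient f v) e ≤ f (v + e) - f v := by
  simpa using hc.inner_gradient_le_slope hf e one_pos

/-- The bound is independent of `t`: it serves as the dominating function when differentiating under
the integral. -/
theorem ConvexOn.abs_slope_le {f : V → ℝ} (hc : ConvexOn ℝ Set.univ f) {v : V}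
    (hf : DifferentiableAt ℝ f v) (e : V) {t : ℝ} (ht : 0 < t) (ht1 : t ≤ 1) :
    |t⁻¹ * (f (v + t • e) - f v)| ≤ |f (v + e) - f v| + |f (v + -e) - f v| := by
  have h1 := hc.slope_le_of_le_one v e ht ht1
  have h2 := hc.inner_gradient_le_slope hf e ht
  have h3 := hc.inner_gradient_le hf (-e)
  rw [inner_neg_right] at h3
  rw [abs_le]
  constructor
  · linarith [neg_abs_le (f (v + e) - f v), le_abs_self (f (v + -e) - f v),
      abs_nonneg (f (v + e) - f v)]
  · linarith [le_abs_self (f (v + e) - f v), abs_nonneg (f (v + -e) - f v)]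

theorem tendsto_slope_gradient {f : V → ℝ} {v : V} (hf : DifferentiableAt ℝ f v) (e : V) :
    Filter.Tendsto (fun k : ℕ => ((1 : ℝ) / (k + 1))⁻¹ * (f (v + ((1 : ℝ) / (k + 1)) • e) - f v))
      Filter.atTop (nhds (inner ℝ (gradient f v) e)) := by
  have h := (hasDerivAt_comp_add_smul hf e).tendsto_slope_zero_right
  have ht : Filter.Tendsto (fun k : ℕ => (1 : ℝ) / (k + 1)) Filter.atTop
      (nhdsWithin 0 (Set.Ioi 0)) :=
    tendsto_nhdsWithin_iff.2 ⟨tendsto_one_div_add_atTop_nhds_zero_nat,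
      Filter.Eventually.of_forall fun k => Set.mem_Ioi.2 Nat.one_div_pos_of_nat⟩
  simpa [Function.comp_def] using h.comp ht

end ConvexGradient

/-! ### Differentiating an expectation of convex functions. -/

section ConvexIntegrand

variable {V : Type*} [NormedAddCommGroup V] [InnerProductSpace ℝ V] [FiniteDimensional ℝ V]
  {Ω : Type*} [MeasurableSpace Ω] {μ : Measure Ω} {φ : V → Ω → ℝ}

theorem one_div_add_one_le_one (k : ℕ) : (1 : ℝ) / (k + 1) ≤ 1 := by
  rw [div_le_one (by positivity)]
  linarith [(k.cast_nonneg : (0 : ℝ) ≤ k)]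

/-- The directional derivatives of a convex integrand at a point are integrable. -/
theorem integrable_inner_gradient (hint : ∀ v, Integrable (φ v) μ)
    (hc : ∀ ω, ConvexOn ℝ Set.univ fun v => φ v ω)
    (hd : ∀ ω, Differentiable ℝ fun v => φ v ω) (v e : V) :
    Integrable (fun ω => inner ℝ (gradient (fun v => φ v ω) v) e) μ := by
  -- The subgradient inequality along `e` and `-e` supplies the integrable bound; measurability
  -- passes to the limit of difference quotients.
  refine Integrable.mono' (((hint (v + e)).sub (hint v)).abs.add
    ((hint (v + -e)).sub (hint v)).abs) ?_ ?_
  · exact aestronglyMeasurable_of_tendsto_ae Filter.atTop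
      (fun k : ℕ => (((hint (v + ((1 : ℝ) / (k + 1)) • e)).sub (hint v)).const_mul
        ((1 : ℝ) / (k + 1))⁻¹).aestronglyMeasurable)
      (Filter.Eventually.of_forall fun ω => tendsto_slope_gradient (hd ω v) e)
  · refine Filter.Eventually.of_forall fun ω => ?_
    have h1 := (hc ω).inner_gradient_le (hd ω v) e
    have h2 := (hc ω).inner_gradient_le (hd ω v) (-e)
    rw [inner_neg_right] at h2
    simp only [Pi.add_apply, Pi.sub_apply, Real.norm_eq_abs]
    rw [abs_le]
    constructor
    · linarith [le_abs_self (φ (v + -e) ω - φ v ω), abs_nonneg (φ (v + e) ω - φ v ω)]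
    · linarith [le_abs_self (φ (v + e) ω - φ v ω), abs_nonneg (φ (v + -e) ω - φ v ω)]

theorem integrable_gradient (hint : ∀ v, Integrable (φ v) μ)
    (hc : ∀ ω, ConvexOn ℝ Set.univ fun v => φ v ω)
    (hd : ∀ ω, Differentiable ℝ fun v => φ v ω) (v : V) :
    Integrable (fun ω => gradient (fun v => φ v ω) v) μ := by
  have h : (fun ω => gradient (fun v => φ v ω) v) = fun ω => ∑ i,
      inner ℝ (gradient (fun v => φ v ω) v) (stdOrthonormalBasis ℝ V i) •
        stdOrthonormalBasis ℝ V i := by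
    funext ω
    conv_lhs => rw [← (stdOrthonormalBasis ℝ V).sum_repr' (gradient (fun v => φ v ω) v)]
    simp_rw [real_inner_comm]
  rw [h]
  exact integrable_finsetSum _ fun i _ =>
    (integrable_inner_gradient hint hc hd v _).smul_const _

theorem inner_integral_gradient (hint : ∀ v, Integrable (φ v) μ)
    (hc : ∀ ω, ConvexOn ℝ Set.univ fun v => φ v ω)
    (hd : ∀ ω, Differentiable ℝ fun v => φ v ω) (v e : V) :
    inner ℝ (∫ ω, gradient (fun v => φ v ω) v ∂μ) e =
      ∫ ω, inner ℝ (gradient (fun v => φ v ω) v) e ∂μ := by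
  rw [real_inner_comm, ← integral_inner (integrable_gradient hint hc hd v)]
  simp_rw [real_inner_comm]

theorem inner_integral_gradient_le (hint : ∀ v, Integrable (φ v) μ)
    (hc : ∀ ω, ConvexOn ℝ Set.univ fun v => φ v ω)
    (hd : ∀ ω, Differentiable ℝ fun v => φ v ω) (v e : V) :
    inner ℝ (∫ ω, gradient (fun v => φ v ω) v ∂μ) e ≤
      (∫ ω, φ (v + e) ω ∂μ) - ∫ ω, φ v ω ∂μ := by
  rw [inner_integral_gradient hint hc hd, ← integral_sub (hint _) (hint _)]
  exact integral_mono (integrable_inner_gradient hint hc hd v e) ((hint _).sub (hint _))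
    fun ω => (hc ω).inner_gradient_le (hd ω v) e

theorem tendsto_slope_integral (hint : ∀ v, Integrable (φ v) μ)
    (hc : ∀ ω, ConvexOn ℝ Set.univ fun v => φ v ω)
    (hd : ∀ ω, Differentiable ℝ fun v => φ v ω) (v e : V) :
    Filter.Tendsto (fun k : ℕ => ((1 : ℝ) / (k + 1))⁻¹ *
        ((∫ ω, φ (v + ((1 : ℝ) / (k + 1)) • e) ω ∂μ) - ∫ ω, φ v ω ∂μ))
      Filter.atTop (nhds (inner ℝ (∫ ω, gradient (fun v => φ v ω) v ∂μ) e)) := by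
  rw [inner_integral_gradient hint hc hd]
  simp_rw [← integral_sub (hint _) (hint _), ← integral_const_mul]
  refine tendsto_integral_of_dominated_convergence
    (fun ω => |φ (v + e) ω - φ v ω| + |φ (v + -e) ω - φ v ω|) ?_ ?_ ?_ ?_
  · exact fun k => (((hint _).sub (hint v)).const_mul _).aestronglyMeasurable
  · exact ((hint (v + e)).sub (hint v)).abs.add ((hint (v + -e)).sub (hint v)).abs
  · exact fun k => Filter.Eventually.of_forall fun ω =>
      (hc ω).abs_slope_le (hd ω v) e Nat.one_div_pos_of_nat (one_div_add_one_le_one k)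
  · exact Filter.Eventually.of_forall fun ω => tendsto_slope_gradient (hd ω v) e

end ConvexIntegrand

/-- A family of subgradients that are directional derivatives depends continuously on a parameter
if the function values do. -/
theorem continuous_of_subgradient {X V : Type*} [TopologicalSpace X] [NormedAddCommGroup V]
    [InnerProductSpace ℝ V] [FiniteDimensional ℝ V] {F : X → V} {ψ : X → V → ℝ}
    (hψ : ∀ e, Continuous fun x => ψ x e)
    (hsub : ∀ x e, inner ℝ (F x) e ≤ ψ x e - ψ x 0)
    (hlim : ∀ x e, Filter.Tendsto (fun k : ℕ => ((1 : ℝ) / (k + 1))⁻¹ *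
      (ψ x (((1 : ℝ) / (k + 1)) • e) - ψ x 0)) Filter.atTop (nhds (inner ℝ (F x) e))) :
    Continuous F := by
  -- If the derivative at `x` is below `c`, so is some quotient; it stays below `c` nearby by
  -- continuity, and it dominates the derivative there.
  have husc : ∀ e x c, inner ℝ (F x) e < c → ∀ᶠ y in nhds x, inner ℝ (F y) e < c := by
    intro e x c hxc
    obtain ⟨k, hk⟩ := ((hlim x e).eventually_lt_const hxc).exists
    have hcont : Continuous fun y => ((1 : ℝ) / (k + 1))⁻¹ *
        (ψ y (((1 : ℝ) / (k + 1)) • e) - ψ y 0) :=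
      continuous_const.mul ((hψ _).sub (hψ 0))
    filter_upwards [hcont.continuousAt.eventually_lt_const hk] with y hy
    refine lt_of_le_of_lt ?_ hy
    have h := hsub y (((1 : ℝ) / (k + 1)) • e)
    rw [real_inner_smul_right] at h
    rwa [le_inv_mul_iff₀ Nat.one_div_pos_of_nat]
  have hin : ∀ e, Continuous fun x => inner ℝ (F x) e := by
    intro e
    refine continuous_iff_continuousAt.2 fun x => tendsto_order.2 ⟨fun c hc => ?_, husc e x⟩
    have h := husc (-e) x (-c) (by simpa using hc)
    exact h.mono fun y hy => by simpa using hy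
  have h : F = fun x => ∑ i, inner ℝ (F x) (stdOrthonormalBasis ℝ V i) •
      stdOrthonormalBasis ℝ V i := by
    funext x
    conv_lhs => rw [← (stdOrthonormalBasis ℝ V).sum_repr' (F x)]
    simp_rw [real_inner_comm]
  rw [h]
  exact continuous_finsetSum _ fun i _ => (hin _).smul continuous_const

/-! ### Unilateral deviations as affine maps. -/

section Deviation

variable {N T : ℕ} {n : Fin N → ℕ}

/-- The profile in which player `i` plays `v` and the others play `0`. -/
noncomputable def singleProfile (i : Fin N) : StrategySpace T (n i) →L[ℝ] ProfileSpace N T n :=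
  ((PiLp.continuousLinearEquiv 2 ℝ fun k : Fin N => StrategySpace T (n k)).symm :
    (∀ k, StrategySpace T (n k)) →L[ℝ] ProfileSpace N T n).comp
      (ContinuousLinearMap.single ℝ (fun k : Fin N => StrategySpace T (n k)) i)

@[simp]
theorem singleProfile_apply_self (i : Fin N) (v : StrategySpace T (n i)) :
    (singleProfile i v : ProfileSpace N T n) i = v := by
  simp [singleProfile]

theorem singleProfile_apply_of_ne {i k : Fin N} (h : k ≠ i) (v : StrategySpace T (n i)) :
    (singleProfile i v : ProfileSpace N T n) k = 0 := by
  simp [singleProfile, h]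

@[simp]
theorem deviate_apply_self (u : ProfileSpace N T n) (i : Fin N) (v : StrategySpace T (n i)) :
    deviate u i v i = v := by
  simp [deviate]

theorem deviate_apply_of_ne (u : ProfileSpace N T n) {i k : Fin N} (h : k ≠ i)
    (v : StrategySpace T (n i)) : deviate u i v k = u k := by
  simp [deviate, h]

theorem deviate_eq_add_singleProfile (u : ProfileSpace N T n) (i : Fin N)
    (v : StrategySpace T (n i)) : deviate u i v = u + singleProfile i (v - u i) := by
  ext1 k
  rcases eq_or_ne k i with rfl | h
  · simp
  · simp [deviate_apply_of_ne u h, singleProfile_apply_of_ne h]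

theorem deviate_self_add (u : ProfileSpace N T n) (i : Fin N) (e : StrategySpace T (n i)) :
    deviate u i (u i + e) = u + singleProfile i e := by
  rw [deviate_eq_add_singleProfile, add_sub_cancel_left]

@[simp]
theorem deviate_self (u : ProfileSpace N T n) (i : Fin N) : deviate u i (u i) = u := by
  simpa using deviate_self_add u i 0

/-- `v ↦ (v, u^{-i})` as an affine map. -/
noncomputable def deviateAffine (u : ProfileSpace N T n) (i : Fin N) :
    StrategySpace T (n i) →ᵃ[ℝ] ProfileSpace N T n :=
  (singleProfile i).toLinearMap.toAffineMap + AffineMap.const ℝ _ (u - singleProfile i (u i))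

theorem deviateAffine_apply (u : ProfileSpace N T n) (i : Fin N) (v : StrategySpace T (n i)) :
    deviateAffine u i v = deviate u i v := by
  simp [deviateAffine, deviate_eq_add_singleProfile]
  abel

theorem differentiable_deviate (u : ProfileSpace N T n) (i : Fin N) :
    Differentiable ℝ (deviate u i) := by
  have : deviate u i = fun v => u + singleProfile i (v - u i) :=
    funext (deviate_eq_add_singleProfile u i)
  rw [this]
  fun_prop

end Deviation

/-! ### State dynamics and expected costs. -/

namespace SGDG

variable {Ω : Type*} [MeasurableSpace Ω] {N T ns m : ℕ} {n : Fin N → ℕ}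
  (G : SGDG Ω N T ns m n)

theorem stateAt_zero (u : ProfileSpace N T n) (ω : Ω) : G.stateAt u ω 0 = G.s₀ := rfl

theorem stateAt_succ (u : ProfileSpace N T n) (ω : Ω) (t : Fin T) :
    G.stateAt u ω t.succ = (G.A t).toEuclideanLin (G.stateAt u ω t.castSucc) +
      ∑ j, (G.B j t).toEuclideanLin (u j t) + G.w t ω := by
  simp [stateAt, Fin.induction_succ]

/-- The noise enters additively, so the linear part does not depend on `ω`. -/
theorem exists_stateAt_eq_add (t : Fin (T + 1)) :
    ∃ L : ProfileSpace N T n →ₗ[ℝ] EuclideanSpace ℝ (Fin ns),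
      ∀ u ω, G.stateAt u ω t = G.stateAt 0 ω t + L u := by
  induction t using Fin.induction with
  | zero => exact ⟨0, fun u ω => by simp [stateAt_zero]⟩
  | succ t ih =>
    obtain ⟨L, hL⟩ := ih
    refine ⟨(G.A t).toEuclideanLin ∘ₗ L + ∑ j, (G.B j t).toEuclideanLin ∘ₗ
      (PiLp.projₗ 2 (fun _ : Fin T => EuclideanSpace ℝ (Fin (n j))) t) ∘ₗ
      (PiLp.projₗ 2 (fun k : Fin N => StrategySpace T (n k)) j), fun u ω => ?_⟩
    rw [stateAt_succ, stateAt_succ, hL u ω]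
    simp
    abel

/-- The state profile is an affine function of the strategies. -/
theorem exists_state_eq_add :
    ∃ L : ProfileSpace N T n →L[ℝ] StateSpace T ns,
      ∀ u ω, G.state u ω = G.state 0 ω + L u := by
  choose L hL using G.exists_stateAt_eq_add
  refine ⟨((PiLp.continuousLinearEquiv 2 ℝ fun _ : Fin (T + 1) => EuclideanSpace ℝ (Fin ns)).symm :
    (Fin (T + 1) → EuclideanSpace ℝ (Fin ns)) →L[ℝ] StateSpace T ns).comp
      (ContinuousLinearMap.pi fun t => LinearMap.toContinuousLinearMap (L t)), fun u ω => ?_⟩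
  ext1 t
  exact hL t u ω

theorem exists_affineMap_eq_state (ω : Ω) :
    ∃ L : ProfileSpace N T n →ᵃ[ℝ] StateSpace T ns, ∀ u, L u = G.state u ω := by
  obtain ⟨L, hL⟩ := G.exists_state_eq_add
  exact ⟨L.toLinearMap.toAffineMap + AffineMap.const ℝ _ (G.state 0 ω), fun u =>
    (add_comm _ _).trans (hL u ω).symm⟩

theorem differentiable_state (ω : Ω) : Differentiable ℝ fun u => G.state u ω := by
  obtain ⟨L, hL⟩ := G.exists_state_eq_add
  have h : (fun u => G.state u ω) = fun u => G.state 0 ω + L u := funext fun u => hL u ω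
  rw [h]
  exact L.differentiable.const_add _

theorem convexOn_comp_state {f : StateSpace T ns → ℝ} (hf : ConvexOn ℝ Set.univ f) (ω : Ω) :
    ConvexOn ℝ Set.univ fun u => f (G.state u ω) := by
  obtain ⟨L, hL⟩ := G.exists_affineMap_eq_state ω
  simpa [Function.comp_def, hL] using hf.comp_affineMap L

variable {G}

namespace CostAssumption

theorem integrable_costState (hG : G.CostAssumption) (i : Fin N) (u : ProfileSpace N T n) :
    Integrable (fun ω => G.costState i (G.state u ω)) G.P := by
  have := G.isProb
  refine ((hG.wellDefined i u).sub (integrable_const (G.costStrat i u))).congr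
    (Filter.Eventually.of_forall fun ω => ?_)
  simp [cost]

/-- The state is affine in the profile, so the expected state part is a finite convex function on a
finite-dimensional space, hence continuous. -/
theorem continuous_expCost (hG : G.CostAssumption) (i : Fin N) : Continuous (G.expCost i) := by
  have := G.isProb
  have h : G.expCost i = fun u => (∫ ω, G.costState i (G.state u ω) ∂G.P) + G.costStrat i u := by
    funext u
    rw [expCost]
    simp only [cost]
    rw [integral_add (hG.integrable_costState i u) (integrable_const _)]
    simp
  have hconv : ConvexOn ℝ Set.univ fun u => ∫ ω, G.costState i (G.state u ω) ∂G.P := by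
    refine ⟨convex_univ, fun u _ v _ a b ha hb hab => ?_⟩
    simp only [smul_eq_mul]
    rw [← integral_const_mul, ← integral_const_mul, ← integral_add
      ((hG.integrable_costState i u).const_mul a) ((hG.integrable_costState i v).const_mul b)]
    exact integral_mono (hG.integrable_costState i _)
      (((hG.integrable_costState i u).const_mul a).add
        ((hG.integrable_costState i v).const_mul b))
      fun ω => (G.convexOn_comp_state (hG.convex_state i) ω).2 (Set.mem_univ u) (Set.mem_univ v)
        ha hb hab
  rw [h]
  exact (continuousOn_univ.1 (hconv.continuousOn isOpen_univ)).add (hG.continuous_strat i)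

theorem convexOn_cost_deviate (hG : G.CostAssumption) (i : Fin N) (u : ProfileSpace N T n)
    (ω : Ω) : ConvexOn ℝ Set.univ fun v => G.cost i (deviate u i v) ω := by
  have h := (G.convexOn_comp_state (hG.convex_state i) ω).comp_affineMap (deviateAffine u i)
  simp only [Set.preimage_univ, Function.comp_def, deviateAffine_apply] at h
  exact h.add (hG.convex_strat i u)

theorem differentiable_cost_deviate (hG : G.CostAssumption) (i : Fin N)
    (u : ProfileSpace N T n) (ω : Ω) :
    Differentiable ℝ fun v => G.cost i (deviate u i v) ω :=
  ((hG.differentiable_state i).comp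
    ((G.differentiable_state ω).comp (differentiable_deviate u i))).add
    (hG.differentiable_strat i u)

theorem integrable_gradCost (hG : G.CostAssumption) (i : Fin N) (u : ProfileSpace N T n) :
    Integrable (fun ω => G.gradCost i u ω) G.P :=
  integrable_gradient (φ := fun v ω => G.cost i (deviate u i v) ω)
    (fun _ => hG.wellDefined i _) (hG.convexOn_cost_deviate i u)
    (hG.differentiable_cost_deviate i u) (u i)

theorem inner_pseudoGradient_le (hG : G.CostAssumption) (i : Fin N) (u : ProfileSpace N T n)
    (e : StrategySpace T (n i)) :
    inner ℝ (G.pseudoGradient u i) e ≤ G.expCost i (u + singleProfile i e) - G.expCost i u := by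
  have h := inner_integral_gradient_le (φ := fun v ω => G.cost i (deviate u i v) ω)
    (fun _ => hG.wellDefined i _) (hG.convexOn_cost_deviate i u)
    (hG.differentiable_cost_deviate i u) (u i) e
  simp only [deviate_self_add, deviate_self] at h
  exact h

theorem continuous_pseudoGradient (hG : G.CostAssumption) : Continuous G.pseudoGradient := by
  refine (PiLp.continuous_toLp 2 _).comp (continuous_pi fun i => ?_)
  refine continuous_of_subgradient (ψ := fun u e => G.expCost i (u + singleProfile i e))
    (fun e => (hG.continuous_expCost i).comp (continuous_id.add continuous_const))
    (fun u e => by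
      rw [map_zero, add_zero]
      exact hG.inner_pseudoGradient_le i u e) fun u e => ?_
  have h := tendsto_slope_integral (φ := fun v ω => G.cost i (deviate u i v) ω)
    (fun _ => hG.wellDefined i _) (hG.convexOn_cost_deviate i u)
    (hG.differentiable_cost_deviate i u) (u i) e
  simp only [deviate_self_add, deviate_self] at h
  simp only [map_zero, add_zero]
  exact h

end CostAssumption

/-! ### The feasible set. -/

theorem isCompact_localSet (i : Fin N) : IsCompact (G.localSet i) := by
  have h : G.localSet i = WithLp.toLp 2 '' Set.univ.pi (G.D i) := by
    ext v
    exact ⟨fun hv => ⟨WithLp.ofLp v, fun t _ => hv t, rfl⟩,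
      by rintro ⟨v, hv, rfl⟩; exact fun t => hv t (Set.mem_univ t)⟩
  rw [h]
  exact (isCompact_univ_pi (G.compact_D i)).image (PiLp.continuous_toLp 2 _)

theorem isCompact_profileSet : IsCompact G.profileSet := by
  have h : G.profileSet = WithLp.toLp 2 '' Set.univ.pi G.localSet := by
    ext u
    exact ⟨fun hu => ⟨WithLp.ofLp u, fun t _ => hu t, rfl⟩,
      by rintro ⟨u, hu, rfl⟩; exact fun t => hu t (Set.mem_univ t)⟩
  rw [h]
  exact (isCompact_univ_pi fun i => G.isCompact_localSet i).image (PiLp.continuous_toLp 2 _)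

theorem integrable_g {C : Set (Ω → ℝ)} (hconc : G.ConcentrationAssumption C) (j : Fin m)
    {u : ProfileSpace N T n} (hu : u ∈ G.profileSet) :
    Integrable (fun ω => G.g u ω j) G.P := by
  have := G.isProb
  exact ((hconc.integrable _ (hconc.con_mem j u hu)).add (integrable_const _)).add
    (integrable_const _)

theorem continuousOn_expCon {C : Set (Ω → ℝ)} (hconc : G.ConcentrationAssumption C)
    (hreg : G.RegularityAssumption) (j : Fin m) : ContinuousOn (G.expCon j) G.profileSet := by
  obtain ⟨ℓ, hℓ, hL⟩ := hreg.lipschitz_g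
  -- The constant `ℓ` is not assumed nonnegative, hence the positive part of its mean.
  refine LipschitzOnWith.continuousOn (K := (∫ ω, ℓ ω ∂G.P).toNNReal)
    (LipschitzOnWith.of_dist_le_mul fun u hu v hv => ?_)
  rw [dist_eq_norm, dist_eq_norm, expCon, expCon,
    ← integral_sub (integrable_g hconc j hu) (integrable_g hconc j hv)]
  refine (norm_integral_le_of_norm_le (hℓ.mul_const ‖u - v‖)
    (Filter.Eventually.of_forall fun ω => ?_)).trans ?_
  · refine le_trans ?_ (hL ω u hu v hv)
    simpa using PiLp.norm_apply_le (G.g u ω - G.g v ω) j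
  · rw [integral_mul_const]
    exact mul_le_mul_of_nonneg_right (Real.le_coe_toNNReal _) (norm_nonneg _)

theorem isCompact_feasibleSet {C : Set (Ω → ℝ)} (hconc : G.ConcentrationAssumption C)
    (hreg : G.RegularityAssumption) : IsCompact G.feasibleSet := by
  -- Integrability is automatic on the profile set. Each sublevel set is intersected with that set
  -- because continuity is known only there.
  have h : G.feasibleSet = G.profileSet ∩ ⋂ j, G.profileSet ∩ G.expCon j ⁻¹' Set.Iic 0 := by
    ext u
    simp only [feasibleSet, Set.mem_ofPred_eq, Set.mem_inter_iff, Set.mem_iInter, Set.mem_preimage,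
      Set.mem_Iic]
    exact ⟨fun hu => ⟨hu.1, fun j => ⟨hu.1, (hu.2 j).2⟩⟩,
      fun hu => ⟨hu.1, fun j => ⟨integrable_g hconc j hu.1, (hu.2 j).2⟩⟩⟩
  rw [h]
  exact isCompact_profileSet.inter_right (isClosed_iInter fun j =>
    (continuousOn_expCon hconc hreg j).preimage_isClosed_of_isClosed
      isCompact_profileSet.isClosed isClosed_Iic)

theorem convex_profileSet : Convex ℝ G.profileSet :=
  fun _ hu _ hv _ _ ha hb hab i t => G.convex_D i t (hu i t) (hv i t) ha hb hab

theorem convex_feasibleSet {C : Set (Ω → ℝ)} (hconc : G.ConcentrationAssumption C)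
    (hreg : G.RegularityAssumption) : Convex ℝ G.feasibleSet := by
  intro u hu v hv a b ha hb hab
  have hmem := convex_profileSet hu.1 hv.1 ha hb hab
  refine ⟨hmem, fun j => ⟨integrable_g hconc j hmem, ?_⟩⟩
  refine ((hreg.slater.convexOn j).2 hu.1 hv.1 ha hb hab).trans ?_
  exact add_nonpos (smul_nonpos_of_nonneg_of_nonpos ha (hu.2 j).2)
    (smul_nonpos_of_nonneg_of_nonpos hb (hv.2 j).2)

theorem nonempty_feasibleSet {C : Set (Ω → ℝ)} (hconc : G.ConcentrationAssumption C)
    (hreg : G.RegularityAssumption) : G.feasibleSet.Nonempty := by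
  obtain ⟨u, hu, hlt⟩ := hreg.slater.exists_strict
  exact ⟨u, hu, fun j => ⟨integrable_g hconc j hu, (hlt j).le⟩⟩

/-! ### Existence of a variational equilibrium. -/

theorem sviSolutions_nonempty {C : Set (Ω → ℝ)} (hcost : G.CostAssumption)
    (hconc : G.ConcentrationAssumption C) (hreg : G.RegularityAssumption) :
    G.sviSolutions.Nonempty := by
  obtain ⟨u, hu, hvi⟩ := exists_variationalInequality_solution (nonempty_feasibleSet hconc hreg)
    (isCompact_feasibleSet hconc hreg) (convex_feasibleSet hconc hreg)
    hcost.continuous_pseudoGradient.continuousOn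
  exact ⟨u, hu, fun i => hcost.integrable_gradCost i u, hvi⟩

/-- Solutions of the variational inequality are equilibria. -/
theorem isSGNE_of_mem_sviSolutions (hcost : G.CostAssumption) {u : ProfileSpace N T n}
    (hu : u ∈ G.sviSolutions) : G.IsSGNE u := by
  refine ⟨hu.1, fun i y hy => ?_⟩
  have h1 := hu.2.2 _ hy.2
  have h2 := hcost.inner_pseudoGradient_le i u (y - u i)
  rw [← deviate_eq_add_singleProfile] at h2
  -- The deviation differs from `u` only in block `i`, so the inner product reduces to that block.
  rw [deviate_eq_add_singleProfile, add_sub_cancel_left, PiLp.inner_apply,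
    Finset.sum_eq_single i (fun k _ hk => by rw [singleProfile_apply_of_ne hk, inner_zero_right])
      (by simp), singleProfile_apply_self] at h1
  linarith

end SGDG

theorem mainTheorem3 {Ω : Type*} [MeasurableSpace Ω] {N T ns m : ℕ} {n : Fin N → ℕ}
    (G : SGDG Ω N T ns m n) (C : Set (Ω → ℝ))
    (hcost : G.CostAssumption)
    (hcon : G.ConstraintAssumption)
    (hconc : G.ConcentrationAssumption C)
    (hreg : G.RegularityAssumption) :
    G.sviSolutions.Nonempty ∧ ∃ u, G.IsVariationalSGNE u := by
  have hne := SGDG.sviSolutions_nonempty hcost hconc hreg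
  obtain ⟨u, hu⟩ := hne
  exact ⟨⟨u, hu⟩, u, SGDG.isSGNE_of_mem_sviSolutions hcost hu, hu⟩
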